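/- Let $n\ge 1$, let $A\in\mathbb{R}^{n\times n}$, $b\in\mathbb{R}^n$ be such that the controllability matrix $[\,b,\,Ab,\dots,A^{n-1}b\,]$ is nonsingular, let $z_0\in\mathbb{R}^n$, $v_{\min}\le v_{\max}$ be real numbers and $t>0$. Let $q^\top$ be the last row of the inverse of the controllability matrix, let $M$ be the matrix with rows $q^\top,q^\top A,\dots,q^\top A^{n-1}$, let $A_{\rm con}=MAM^{-1}$, $b_{\rm con}=Mb=(0,\dots,0,1)^\top$, $x_0=Mz_0$, and let $c=(c_0,\dots,c_{n-1})^\top$ be the vector of the lower coefficients of the monic characteristic polynomial $\lambda^n+c_{n-1}\lambda^{n-1}+\dots+c_0$ of $A$. For $0\le s\le t$ put $f_s(\tau)=\langle c,e^{(s-\tau)A_{\rm con}}b_{\rm con}\rangle$ and let $I_{\min}(s)$ and $I_{\max}(s)$ be the infimum and the supremum of $v(s)-\int_0^s f_s(\tau)v(\tau)\,d\tau$ over the continuous $v:[0,s]\to[v_{\min},v_{\max}]$. These are finite and $$I_{\min}(s)=v_{\min}-v_{\min}\int_{\{\tau\in[0,s]:f_s(\tau)\le0\}}f_s\,d\tau-v_{\max}\int_{\{\tau\in[0,s]:f_s(\tau)>0\}}f_s\,d\tau,$$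 $$I_{\max}(s)=v_{\max}-v_{\max}\int_{\{\tau\in[0,s]:f_s(\tau)\le0\}}f_s\,d\tau-v_{\min}\int_{\{\tau\in[0,s]:f_s(\tau)>0\}}f_s\,d\tau.$$ Put $u_{\min}(s)=-\langle c,e^{sA_{\rm con}}Mz_0\rangle+I_{\min}(s)$, $u_{\max}(s)=-\langle c,e^{sA_{\rm con}}Mz_0\rangle+I_{\max}(s)$, $\mu=(u_{\max}-u_{\min})/2$ and $\nu=(u_{\max}+u_{\min})/2$. Let $\mathcal{X}_t\subset\mathbb{R}^n$ be the set of all $x(t)$, where $x$ solves $\dot x=A_{\rm int}x+b_{\rm con}u$ on $[0,t]$, $x(0)=x_0$, for some continuous $u$ on $[0,t]$ with $u(s)\in[u_{\min}(s),u_{\max}(s)]$ for all $s\in[0,t]$; here $A_{\rm int}$ is the $n\times n$ matrix with ones on the first superdiagonal and zeros elsewhere. Let $$\chi_k=\sum_{\ell=k}^n\frac{t^{\ell-k}}{(\ell-k)!}(x_0)_\ell\quad(1\le k\le n),\qquad \xi(s)=\Big(\frac{s^{n-1}}{(n-1)!},\frac{s^{n-2}}{(n-2)!},\dots,s,1\Big)^{\top},$$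 $\mathcal{W}_t=\{\sigma\in\mathbb{R}^{n-1}:0\le\sigma_1\le\dots\le\sigma_{n-1}\le t\}$ and, with $\sigma_0=0$ and $\sigma_n=t$, $$x^{\rm upper}(\sigma)=\chi+\int_0^t\nu(s)\xi(t-s)\,ds+\sum_{k=1}^{n}(-1)^{k-1}\int_{\sigma_{k-1}}^{\sigma_k}\mu(s)\xi(t-s)\,ds,$$ $$x^{\rm lower}(\sigma)=\chi+\int_0^t\nu(s)\xi(t-s)\,ds-\sum_{k=1}^{n}(-1)^{k-1}\int_{\sigma_{k-1}}^{\sigma_k}\mu(s)\xi(t-s)\,ds.$$ Then the topological boundary of $\mathcal{X}_t$ is the union of an upper and a lower bounding surface, $$\partial\mathcal{X}_t=\{x^{\rm upper}(\sigma):\sigma\in\mathcal{W}_t\}\cup\{x^{\rm lower}(\sigma):\sigma\in\mathcal{W}_t\}.$$ -/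

import Mathlib

open scoped Matrix

noncomputable section

namespace Reach

/-! Throughout the state dimension is `n = m + 1 ≥ 1`; vectors of `ℝⁿ` are functions
`Fin (m + 1) → ℝ` and the component with one-based index `k + 1` has index `k`. -/

/-- The controllability matrix `[b, A b, …, A ^ (n - 1) b]`. -/
def ctrbMatrix {m : ℕ} (A : Matrix (Fin (m + 1)) (Fin (m + 1)) ℝ) (b : Fin (m + 1) → ℝ) :
    Matrix (Fin (m + 1)) (Fin (m + 1)) ℝ :=
  Matrix.of fun i j => ((A ^ (j : ℕ)) *ᵥ b) i

/-- `(A, b)` is a controllable pair: the controllability matrix has full rank. -/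
def IsControllable {m : ℕ} (A : Matrix (Fin (m + 1)) (Fin (m + 1)) ℝ)
    (b : Fin (m + 1) → ℝ) : Prop :=
  (ctrbMatrix A b).rank = m + 1

/-- The last row `qᵀ` of the inverse of the controllability matrix. -/
def qRow {m : ℕ} (A : Matrix (Fin (m + 1)) (Fin (m + 1)) ℝ) (b : Fin (m + 1) → ℝ) :
    Fin (m + 1) → ℝ :=
  fun j => (ctrbMatrix A b)⁻¹ (Fin.last m) j

/-- The matrix `M` with rows `qᵀ, qᵀ A, …, qᵀ A ^ (n - 1)`. -/
def canonM {m : ℕ} (A : Matrix (Fin (m + 1)) (Fin (m + 1)) ℝ) (b : Fin (m + 1) → ℝ) :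
    Matrix (Fin (m + 1)) (Fin (m + 1)) ℝ :=
  Matrix.of fun i j => (qRow A b ᵥ* (A ^ (i : ℕ))) j

/-- The state matrix `M A M⁻¹` of the controllable canonical form. -/
def Acon {m : ℕ} (A : Matrix (Fin (m + 1)) (Fin (m + 1)) ℝ) (b : Fin (m + 1) → ℝ) :
    Matrix (Fin (m + 1)) (Fin (m + 1)) ℝ :=
  canonM A b * A * (canonM A b)⁻¹

/-- The input vector `M b` of the controllable canonical form. -/
def bcon {m : ℕ} (A : Matrix (Fin (m + 1)) (Fin (m + 1)) ℝ) (b : Fin (m + 1) → ℝ) :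
    Fin (m + 1) → ℝ :=
  canonM A b *ᵥ b

/-- The coefficients `(c₀, …, c_{n-1})` of the characteristic polynomial
`λ ^ n + c_{n-1} λ ^ (n - 1) + ⋯ + c₀` of `A`. -/
def charCoeff {m : ℕ} (A : Matrix (Fin (m + 1)) (Fin (m + 1)) ℝ) : Fin (m + 1) → ℝ :=
  fun i => A.charpoly.coeff (i : ℕ)

/-- The state matrix of the `n`th order integrator: ones on the first superdiagonal. -/
def Aint (m : ℕ) : Matrix (Fin (m + 1)) (Fin (m + 1)) ℝ :=
  Matrix.of fun i j => if (j : ℕ) = (i : ℕ) + 1 then 1 else 0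

/-- `f(τ) = ⟨c, exp ((s - τ) A_con) b_con⟩`, with the dependence on `s` made explicit. -/
def kernelF {m : ℕ} (A : Matrix (Fin (m + 1)) (Fin (m + 1)) ℝ) (b : Fin (m + 1) → ℝ)
    (s τ : ℝ) : ℝ :=
  charCoeff A ⬝ᵥ (NormedSpace.exp ((s - τ) • Acon A b) *ᵥ bcon A b)

/-- The functional `I(v) = v(s) - ∫₀ˢ f(τ) v(τ) dτ`. -/
def functionalI {m : ℕ} (A : Matrix (Fin (m + 1)) (Fin (m + 1)) ℝ) (b : Fin (m + 1) → ℝ)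
    (s : ℝ) (v : ℝ → ℝ) : ℝ :=
  v s - ∫ τ in (0 : ℝ)..s, kernelF A b s τ * v τ

/-- The values `I(v)` over the continuous `v` on `[0, s]` with `vmin ≤ v ≤ vmax`. -/
def valuesI {m : ℕ} (A : Matrix (Fin (m + 1)) (Fin (m + 1)) ℝ) (b : Fin (m + 1) → ℝ)
    (vmin vmax s : ℝ) : Set ℝ :=
  {r | ∃ v : ℝ → ℝ, ContinuousOn v (Set.Icc 0 s) ∧
    (∀ τ ∈ Set.Icc 0 s, v τ ∈ Set.Icc vmin vmax) ∧ r = functionalI A b s v}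

def Imin {m : ℕ} (A : Matrix (Fin (m + 1)) (Fin (m + 1)) ℝ) (b : Fin (m + 1) → ℝ)
    (vmin vmax s : ℝ) : ℝ :=
  sInf (valuesI A b vmin vmax s)

def Imax {m : ℕ} (A : Matrix (Fin (m + 1)) (Fin (m + 1)) ℝ) (b : Fin (m + 1) → ℝ)
    (vmin vmax s : ℝ) : ℝ :=
  sSup (valuesI A b vmin vmax s)

/-- `∫ f` over the zero sublevel set of `f` in `[0, s]`. -/
def intSub {m : ℕ} (A : Matrix (Fin (m + 1)) (Fin (m + 1)) ℝ) (b : Fin (m + 1) → ℝ)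
    (s : ℝ) : ℝ :=
  ∫ τ in {τ | τ ∈ Set.Icc 0 s ∧ kernelF A b s τ ≤ 0}, kernelF A b s τ

/-- `∫ f` over the strict zero superlevel set of `f` in `[0, s]`. -/
def intSuper {m : ℕ} (A : Matrix (Fin (m + 1)) (Fin (m + 1)) ℝ) (b : Fin (m + 1) → ℝ)
    (s : ℝ) : ℝ :=
  ∫ τ in {τ | τ ∈ Set.Icc 0 s ∧ 0 < kernelF A b s τ}, kernelF A b s τ

/-- The lower end `-⟨c, exp (s A_con) M z₀⟩ + I_min(s)` of the time-varying range. -/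
def umin {m : ℕ} (A : Matrix (Fin (m + 1)) (Fin (m + 1)) ℝ) (b z₀ : Fin (m + 1) → ℝ)
    (vmin vmax s : ℝ) : ℝ :=
  -(charCoeff A ⬝ᵥ (NormedSpace.exp (s • Acon A b) *ᵥ (canonM A b *ᵥ z₀)))
    + Imin A b vmin vmax s

/-- The upper end `-⟨c, exp (s A_con) M z₀⟩ + I_max(s)` of the time-varying range. -/
def umax {m : ℕ} (A : Matrix (Fin (m + 1)) (Fin (m + 1)) ℝ) (b z₀ : Fin (m + 1) → ℝ)
    (vmin vmax s : ℝ) : ℝ :=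
  -(charCoeff A ⬝ᵥ (NormedSpace.exp (s • Acon A b) *ᵥ (canonM A b *ᵥ z₀)))
    + Imax A b vmin vmax s

/-- The reach set at time `t` from `x₀` of `ẋ = F x + g u` over the continuous inputs `u` on
`[0, t]` with `u(s) ∈ [lo(s), hi(s)]` for all `s ∈ [0, t]`. -/
def reachSet {m : ℕ} (F : Matrix (Fin (m + 1)) (Fin (m + 1)) ℝ) (g : Fin (m + 1) → ℝ)
    (lo hi : ℝ → ℝ) (t : ℝ) (x₀ : Fin (m + 1) → ℝ) : Set (Fin (m + 1) → ℝ) :=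
  {y | ∃ (u : ℝ → ℝ) (x : ℝ → Fin (m + 1) → ℝ),
    ContinuousOn u (Set.Icc 0 t) ∧
    (∀ s ∈ Set.Icc 0 t, u s ∈ Set.Icc (lo s) (hi s)) ∧
    x 0 = x₀ ∧
    (∀ s ∈ Set.Icc 0 t, HasDerivWithinAt x (F *ᵥ x s + u s • g) (Set.Icc 0 t) s) ∧
    y = x t}

/-- `χ_k(t, x₀) = ∑_{ℓ ≥ k} t ^ (ℓ - k) / (ℓ - k)! * x₀_ℓ`. -/
def chi {m : ℕ} (t : ℝ) (x₀ : Fin (m + 1) → ℝ) : Fin (m + 1) → ℝ :=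
  fun k => ∑ l : Fin (m + 1),
    if k ≤ l then t ^ ((l : ℕ) - (k : ℕ)) / (((l : ℕ) - (k : ℕ)).factorial : ℝ) * x₀ l else 0

/-- `ξ(s) = (s ^ (n - 1) / (n - 1)!, …, s, 1)`. -/
def xi (m : ℕ) (s : ℝ) : Fin (m + 1) → ℝ :=
  fun k => s ^ (m - (k : ℕ)) / ((m - (k : ℕ)).factorial : ℝ)

/-- The set of `σ ∈ ℝ ^ (n - 1)` with `0 ≤ σ₁ ≤ ⋯ ≤ σ_{n-1} ≤ t`. -/
def weylChamber (m : ℕ) (t : ℝ) : Set (Fin m → ℝ) :=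
  {σ | Monotone σ ∧ ∀ i, σ i ∈ Set.Icc 0 t}

/-- The `n + 1` points `0, σ₁, …, σ_{n-1}, t`. -/
def nodes {m : ℕ} (t : ℝ) (σ : Fin m → ℝ) : Fin (m + 2) → ℝ :=
  Fin.cons 0 (Fin.snoc σ t : Fin (m + 1) → ℝ)

/-- `∫₀^σ₁ μ(s) ξ(t-s) ds - ∫_σ₁^σ₂ μ(s) ξ(t-s) ds + ⋯ + (-1)^(n-1) ∫_σ_{n-1}^t μ(s) ξ(t-s) ds`. -/
def alternating {m : ℕ} (μ : ℝ → ℝ) (t : ℝ) (σ : Fin m → ℝ) : Fin (m + 1) → ℝ :=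
  ∑ k : Fin (m + 1), (-1 : ℝ) ^ (k : ℕ) •
    ∫ s in (nodes t σ k.castSucc)..(nodes t σ k.succ), μ s • xi m (t - s)

/-- The half-width of the range `[lo, hi]`. -/
def halfWidth (lo hi : ℝ → ℝ) (s : ℝ) : ℝ := (hi s - lo s) / 2

/-- The midpoint of the range `[lo, hi]`. -/
def midpt (lo hi : ℝ → ℝ) (s : ℝ) : ℝ := (hi s + lo s) / 2

def xUpper {m : ℕ} (lo hi : ℝ → ℝ) (t : ℝ) (x₀ : Fin (m + 1) → ℝ) (σ : Fin m → ℝ) :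
    Fin (m + 1) → ℝ :=
  chi t x₀ + (∫ s in (0 : ℝ)..t, midpt lo hi s • xi m (t - s)) +
    alternating (halfWidth lo hi) t σ

def xLower {m : ℕ} (lo hi : ℝ → ℝ) (t : ℝ) (x₀ : Fin (m + 1) → ℝ) (σ : Fin m → ℝ) :
    Fin (m + 1) → ℝ :=
  chi t x₀ + (∫ s in (0 : ℝ)..t, midpt lo hi s • xi m (t - s)) -
    alternating (halfWidth lo hi) t σ

def upperSurface {m : ℕ} (lo hi : ℝ → ℝ) (t : ℝ) (x₀ : Fin (m + 1) → ℝ) :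
    Set (Fin (m + 1) → ℝ) :=
  xUpper lo hi t x₀ '' weylChamber m t

def lowerSurface {m : ℕ} (lo hi : ℝ → ℝ) (t : ℝ) (x₀ : Fin (m + 1) → ℝ) :
    Set (Fin (m + 1) → ℝ) :=
  xLower lo hi t x₀ '' weylChamber m t

end Reach

end

/-! By variation of constants the reach set of the integrator is a translate of the set of moments
`∫ w(s) ξ(t - s) ds` over the continuous weights `|w| ≤ μ`, which is convex. At a boundary point a
supporting functional `f` forces `w` to be `μ` times the sign of the switching function
`s ↦ f (ξ (t - s))`, a polynomial of degree less than `n`, so `w` has at most `n - 1` switches.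
Conversely, every switching pattern is the sign pattern of such a polynomial, and the
corresponding moment maximizes the functional. The extreme values of `I` are approached by
continuous weights switching with the sign of the kernel, and the resulting formulas show that the
ends of the input range are continuous. -/

open Filter Topology MeasureTheory Set

namespace Reach

section ConvexSets

variable {E : Type*} [NormedAddCommGroup E] [NormedSpace ℝ E] {K : Set E} {y : E}

theorem notMem_interior_of_isMaxOn {f : E →L[ℝ] ℝ} (hf : f ≠ 0) (hmax : IsMaxOn f K y) :
    y ∉ interior K := fun hy =>
  hf ((hmax.isLocalMax (mem_interior_iff_mem_nhds.1 hy)).hasFDerivAt_eq_zero f.hasFDerivAt)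

theorem exists_isMaxOn_closure_of_mem_frontier [FiniteDimensional ℝ E] (hK : Convex ℝ K)
    (hy : y ∈ frontier K) : ∃ f : E →L[ℝ] ℝ, f ≠ 0 ∧ IsMaxOn f (closure K) y := by
  suffices h : ∃ f : E →L[ℝ] ℝ, f ≠ 0 ∧ IsMaxOn f K y by
    obtain ⟨f, hf, hmax⟩ := h
    exact ⟨f, hf, hmax.closure f.continuous.continuousOn⟩
  by_cases hint : (interior K).Nonempty
  · obtain ⟨f, u, hf, hKu, huy⟩ := geometric_hahn_banach_of_nonempty_interior hK
      (convex_singleton y) (disjoint_singleton_right.2 hy.2) hint (singleton_nonempty y)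
    exact ⟨f, hf, fun x hx => (hKu x hx).trans (huy y rfl)⟩
  · obtain ⟨x₀, hx₀⟩ : K.Nonempty := closure_nonempty_iff.1 ⟨y, hy.1⟩
    rw [hK.interior_nonempty_iff_affineSpan_eq_top,
      AffineSubspace.affineSpan_eq_top_iff_vectorSpan_eq_top_of_nonempty ℝ E E ⟨x₀, hx₀⟩] at hint
    obtain ⟨f, hf, hle⟩ := Submodule.exists_le_ker_of_lt_top _ (lt_top_iff_ne_top.2 hint)
    have hconst : EqOn f.toContinuousLinearMap (fun _ => f x₀) K := fun x hx =>
      sub_eq_zero.1 ((map_sub f x x₀).symm.trans (hle (vsub_mem_vectorSpan ℝ hx hx₀)))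
    have hy₀ : f y = f x₀ :=
      hconst.closure f.toContinuousLinearMap.continuous continuous_const hy.1
    exact ⟨f.toContinuousLinearMap, by simpa using hf, fun x hx => ((hconst hx).trans hy₀.symm).le⟩

end ConvexSets

section SoftSign

/-- A continuous approximation of the sign function, converging to it pointwise as `k → ∞`. -/
noncomputable def softSign (k : ℕ) (x : ℝ) : ℝ := x / (|x| + 1 / ((k : ℝ) + 1))

theorem continuous_softSign (k : ℕ) : Continuous (softSign k) :=
  continuous_id.div (by fun_prop) fun x => by positivity

theorem abs_softSign_le_one (k : ℕ) (x : ℝ) : |softSign k x| ≤ 1 := by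
  have hden : 0 < |x| + 1 / ((k : ℝ) + 1) := by positivity
  rw [softSign, abs_div, abs_of_pos hden, div_le_one hden]
  exact le_add_of_nonneg_right (by positivity)

theorem tendsto_softSign (x : ℝ) :
    Tendsto (fun k => softSign k x) atTop (𝓝 (SignType.sign x : ℝ)) := by
  rcases eq_or_ne x 0 with rfl | hx
  · simp [softSign]
  · have hden := (tendsto_one_div_add_atTop_nhds_zero_nat (𝕜 := ℝ)).const_add |x|
    rw [add_zero] at hden
    rw [← (div_eq_iff (abs_ne_zero.2 hx)).2 (sign_mul_abs x).symm]
    exact tendsto_const_nhds.div hden (abs_ne_zero.2 hx)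

end SoftSign

section MomentSet

variable {E : Type*} [NormedAddCommGroup E] [NormedSpace ℝ E] {X : ℝ → E} {μ : ℝ → ℝ} {a b : ℝ}

/-- The moments `∫ w X` of the curve `X` on `[a, b]` against the continuous weights `w` with
`|w| ≤ μ`. Allowing zeros of `μ` makes degenerate input ranges an ordinary case. -/
def momentSet (μ : ℝ → ℝ) (X : ℝ → E) (a b : ℝ) : Set E :=
  {y | ∃ w : ℝ → ℝ, ContinuousOn w (Icc a b) ∧ (∀ s ∈ Icc a b, |w s| ≤ μ s) ∧
    y = ∫ s in a..b, w s • X s}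

/-- The moment against the extreme weight `μ` times the sign of the switching function
`s ↦ f (X s)`. -/
noncomputable def bangBang (μ : ℝ → ℝ) (X : ℝ → E) (a b : ℝ) (f : E →L[ℝ] ℝ) : E :=
  ∫ s in a..b, (SignType.sign (f (X s)) : ℝ) • μ s • X s

theorem convex_momentSet (hab : a ≤ b) (hX : ContinuousOn X (Icc a b)) :
    Convex ℝ (momentSet μ X a b) := by
  rintro _ ⟨v, hv, hvμ, rfl⟩ _ ⟨w, hw, hwμ, rfl⟩ p q hp hq hpq
  refine ⟨fun s => p * v s + q * w s, by fun_prop, fun s hs => ?_, ?_⟩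
  · calc |p * v s + q * w s| ≤ |p * v s| + |q * w s| := abs_add_le _ _
      _ = p * |v s| + q * |w s| := by rw [abs_mul, abs_mul, abs_of_nonneg hp, abs_of_nonneg hq]
      _ ≤ p * μ s + q * μ s := by gcongr <;> [exact hvμ s hs; exact hwμ s hs]
      _ = μ s := by rw [← add_mul, hpq, one_mul]
  · have hvX := ((hv.smul hX).intervalIntegrable_of_Icc (μ := volume) hab).smul p
    have hwX := ((hw.smul hX).intervalIntegrable_of_Icc (μ := volume) hab).smul q
    simp only [add_smul, mul_smul, ← intervalIntegral.integral_smul]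
    exact (intervalIntegral.integral_add hvX hwX).symm

theorem intervalIntegrable_sign_smul {g : ℝ → ℝ} (hab : a ≤ b) (hg : ContinuousOn g (Icc a b))
    (hX : ContinuousOn X (Icc a b)) :
    IntervalIntegrable (fun s => (SignType.sign (g s) : ℝ) • X s) volume a b := by
  have hXint : IntegrableOn X (Icc a b) := hX.integrableOn_Icc
  refine (intervalIntegrable_iff_integrableOn_Icc_of_le hab).2
    (Integrable.mono hXint (.smul ?_ hXint.aestronglyMeasurable) (ae_of_all _ fun s => ?_))
  · exact aestronglyMeasurable_of_tendsto_ae atTop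
      (fun k => ((continuous_softSign k).comp_continuousOn hg).aestronglyMeasurable
        measurableSet_Icc) (ae_of_all _ fun s => tendsto_softSign (g s))
  · have hsign : |((SignType.sign (g s) : SignType) : ℝ)| ≤ 1 := by
      cases SignType.sign (g s) <;> simp
    rw [norm_smul, Real.norm_eq_abs]
    exact mul_le_of_le_one_left (norm_nonneg _) hsign

theorem tendsto_integral_smul_of_abs_le (hab : a ≤ b) (hμ : ContinuousOn μ (Icc a b))
    (hX : ContinuousOn X (Icc a b)) {w : ℕ → ℝ → ℝ} (hw : ∀ k, ContinuousOn (w k) (Icc a b))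
    (hwμ : ∀ k, ∀ s ∈ Icc a b, |w k s| ≤ μ s) {v : ℝ → ℝ}
    (hlim : ∀ᵐ s ∂volume.restrict (Ioc a b), Tendsto (fun k => w k s) atTop (𝓝 (v s))) :
    Tendsto (fun k => ∫ s in a..b, w k s • X s) atTop (𝓝 (∫ s in a..b, v s • X s)) := by
  simp only [intervalIntegral.integral_of_le hab]
  refine tendsto_integral_of_dominated_convergence (fun s => μ s * ‖X s‖) (fun k => ?_) ?_
    (fun k => ?_) (hlim.mono fun s hs => hs.smul_const _)
  · exact (((hw k).smul hX).mono Ioc_subset_Icc_self).aestronglyMeasurable measurableSet_Ioc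
  · exact ((hμ.mul hX.norm).integrableOn_Icc).mono_set Ioc_subset_Icc_self
  · filter_upwards [ae_restrict_mem measurableSet_Ioc] with s hs
    rw [norm_smul, Real.norm_eq_abs]
    gcongr
    exact hwμ k s (Ioc_subset_Icc_self hs)

theorem bangBang_mem_closure (hab : a ≤ b) (hμ : ContinuousOn μ (Icc a b))
    (hμ0 : ∀ s ∈ Icc a b, 0 ≤ μ s) (hX : ContinuousOn X (Icc a b)) (f : E →L[ℝ] ℝ) :
    bangBang μ X a b f ∈ closure (momentSet μ X a b) := by
  let w : ℕ → ℝ → ℝ := fun k s => softSign k (f (X s)) * μ s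
  have hw : ∀ k, ContinuousOn (w k) (Icc a b) := fun k =>
    ((continuous_softSign k).comp_continuousOn (f.continuous.comp_continuousOn hX)).mul hμ
  have hwμ : ∀ k, ∀ s ∈ Icc a b, |w k s| ≤ μ s := fun k s hs => by
    rw [abs_mul, abs_of_nonneg (hμ0 s hs)]
    exact mul_le_of_le_one_left (hμ0 s hs) (abs_softSign_le_one k _)
  have hlim := tendsto_integral_smul_of_abs_le hab hμ hX hw hwμ
    (ae_of_all _ fun s => (tendsto_softSign (f (X s))).mul_const (μ s))
  simp only [bangBang, ← mul_smul]
  exact mem_closure_of_tendsto hlim (.of_forall fun k => ⟨w k, hw k, hwμ k, rfl⟩)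

theorem apply_integral_smul [CompleteSpace E] {w : ℝ → ℝ}
    (hwX : IntervalIntegrable (fun s => w s • X s) volume a b) (f : E →L[ℝ] ℝ) :
    f (∫ s in a..b, w s • X s) = ∫ s in a..b, w s * f (X s) := by
  simp only [← f.intervalIntegral_comp_comm hwX, map_smul, smul_eq_mul]

theorem apply_bangBang [CompleteSpace E] (hab : a ≤ b) (hμ : ContinuousOn μ (Icc a b))
    (hX : ContinuousOn X (Icc a b)) (f : E →L[ℝ] ℝ) :
    f (bangBang μ X a b f) = ∫ s in a..b, μ s * |f (X s)| := by
  have hint : IntervalIntegrable (fun s => (SignType.sign (f (X s)) : ℝ) • μ s • X s) volume a b :=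
    intervalIntegrable_sign_smul hab (f.continuous.comp_continuousOn hX) (hμ.smul hX)
  rw [bangBang, apply_integral_smul hint]
  simp only [map_smul, smul_eq_mul, mul_left_comm, sign_mul_self]

theorem mul_le_mul_abs_of_abs_le {c w z : ℝ} (hw : |w| ≤ c) : w * z ≤ c * |z| :=
  calc w * z ≤ |w| * |z| := (le_abs_self _).trans (abs_mul w z).le
    _ ≤ c * |z| := by gcongr

theorem isMaxOn_bangBang [CompleteSpace E] (hab : a ≤ b) (hμ : ContinuousOn μ (Icc a b))
    (hX : ContinuousOn X (Icc a b)) (f : E →L[ℝ] ℝ) :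
    IsMaxOn f (momentSet μ X a b) (bangBang μ X a b f) := by
  have hfX : ContinuousOn (fun s => f (X s)) (Icc a b) := f.continuous.comp_continuousOn hX
  refine isMaxOn_iff.2 ?_
  rintro _ ⟨w, hw, hwμ, rfl⟩
  rw [apply_bangBang hab hμ hX,
    apply_integral_smul ((hw.smul hX).intervalIntegrable_of_Icc hab)]
  exact intervalIntegral.integral_mono_on hab ((hw.mul hfX).intervalIntegrable_of_Icc hab)
    ((hμ.mul hfX.abs).intervalIntegrable_of_Icc hab)
    fun s hs => mul_le_mul_abs_of_abs_le (hwμ s hs)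

theorem exists_seq_tendsto_ae_zero_of_tendsto_integral {α : Type*} {mα : MeasurableSpace α}
    {ν : Measure α} {d : ℕ → α → ℝ} (hint : ∀ k, Integrable (d k) ν) (hd0 : ∀ k, 0 ≤ᵐ[ν] d k)
    (hlim : Tendsto (fun k => ∫ x, d k x ∂ν) atTop (𝓝 0)) :
    ∃ φ : ℕ → ℕ, StrictMono φ ∧ ∀ᵐ x ∂ν, Tendsto (fun k => d (φ k) x) atTop (𝓝 0) := by
  refine TendstoInMeasure.exists_seq_tendsto_ae (tendstoInMeasure_of_tendsto_eLpNorm one_ne_zero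
    (fun k => (hint k).aestronglyMeasurable) aestronglyMeasurable_const ?_)
  have hnorm : ∀ k, eLpNorm (d k - fun _ => (0 : ℝ)) 1 ν = ENNReal.ofReal (∫ x, d k x ∂ν) :=
    fun k => by
      rw [eLpNorm_one_eq_lintegral_enorm,
        ofReal_integral_eq_lintegral_ofReal (hint k) (hd0 k)]
      refine lintegral_congr_ae ((hd0 k).mono fun x hx => ?_)
      simp [Real.enorm_eq_ofReal hx]
  simpa only [hnorm, ENNReal.ofReal_zero] using ENNReal.tendsto_ofReal hlim

theorem tendsto_weight_of_tendsto_mul {ι : Type*} {l : Filter ι} {w : ι → ℝ} {c z : ℝ}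
    (hz : z ≠ 0) (hlim : Tendsto (fun k => c * |z| - w k * z) l (𝓝 0)) :
    Tendsto w l (𝓝 (SignType.sign z * c)) := by
  have hquot := (hlim.const_sub (c * |z|)).div_const z
  simp only [sub_sub_cancel, mul_div_cancel_right₀ _ hz, sub_zero] at hquot
  rwa [← self_mul_sign z, mul_left_comm, mul_div_cancel_left₀ _ hz, mul_comm] at hquot

theorem exists_seq_tendsto_ae_sign_mul (hab : a ≤ b) (hμ : ContinuousOn μ (Icc a b)) {g : ℝ → ℝ}
    (hg : ContinuousOn g (Icc a b)) (hg0 : ∀ᵐ s ∂volume.restrict (Ioc a b), g s ≠ 0)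
    {w : ℕ → ℝ → ℝ} (hw : ∀ k, ContinuousOn (w k) (Icc a b))
    (hwμ : ∀ k, ∀ s ∈ Icc a b, |w k s| ≤ μ s)
    (hlim : Tendsto (fun k => ∫ s in a..b, w k s * g s) atTop (𝓝 (∫ s in a..b, μ s * |g s|))) :
    ∃ φ : ℕ → ℕ, StrictMono φ ∧ ∀ᵐ s ∂volume.restrict (Ioc a b),
      Tendsto (fun k => w (φ k) s) atTop (𝓝 (SignType.sign (g s) * μ s)) := by
  let d : ℕ → ℝ → ℝ := fun k s => μ s * |g s| - w k s * g s
  have hd : ∀ k, IntegrableOn (d k) (Ioc a b) := fun k =>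
    ((hμ.mul hg.abs).sub ((hw k).mul hg)).integrableOn_Icc.mono_set Ioc_subset_Icc_self
  have hd0 : ∀ k, 0 ≤ᵐ[volume.restrict (Ioc a b)] d k := fun k =>
    (ae_restrict_mem measurableSet_Ioc).mono fun s hs =>
      sub_nonneg.2 (mul_le_mul_abs_of_abs_le (hwμ k s (Ioc_subset_Icc_self hs)))
  have hdlim : Tendsto (fun k => ∫ s in Ioc a b, d k s) atTop (𝓝 0) := by
    have hdint : ∀ k, ∫ s in Ioc a b, d k s =
        (∫ s in a..b, μ s * |g s|) - ∫ s in a..b, w k s * g s := fun k => by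
      rw [← intervalIntegral.integral_of_le hab]
      exact intervalIntegral.integral_sub ((hμ.mul hg.abs).intervalIntegrable_of_Icc hab)
        (((hw k).mul hg).intervalIntegrable_of_Icc hab)
    simpa only [hdint, sub_self] using hlim.const_sub (∫ s in a..b, μ s * |g s|)
  obtain ⟨φ, hφ, hφlim⟩ := exists_seq_tendsto_ae_zero_of_tendsto_integral hd hd0 hdlim
  refine ⟨φ, hφ, ?_⟩
  filter_upwards [hφlim, hg0] with s hs hne using tendsto_weight_of_tendsto_mul hne hs

theorem eq_bangBang_of_isMaxOn [CompleteSpace E] (hab : a ≤ b) (hμ : ContinuousOn μ (Icc a b))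
    (hμ0 : ∀ s ∈ Icc a b, 0 ≤ μ s) (hX : ContinuousOn X (Icc a b)) {f : E →L[ℝ] ℝ}
    (hfX0 : ∀ᵐ s ∂volume.restrict (Ioc a b), f (X s) ≠ 0) {y : E}
    (hy : y ∈ closure (momentSet μ X a b)) (hmax : IsMaxOn f (closure (momentSet μ X a b)) y) :
    y = bangBang μ X a b f := by
  have hfy : f y = ∫ s in a..b, μ s * |f (X s)| := by
    rw [← apply_bangBang hab hμ hX]
    exact le_antisymm ((isMaxOn_bangBang hab hμ hX f).closure f.continuous.continuousOn hy)
      (hmax (bangBang_mem_closure hab hμ hμ0 hX f))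
  obtain ⟨x, hx, hxy⟩ := mem_closure_iff_seq_limit.1 hy
  choose w hw hwμ hxw using hx
  have hfx : ∀ k, f (x k) = ∫ s in a..b, w k s * f (X s) := fun k => by
    rw [hxw, apply_integral_smul (((hw k).smul hX).intervalIntegrable_of_Icc hab)]
  have hlim : Tendsto (fun k => ∫ s in a..b, w k s * f (X s)) atTop
      (𝓝 (∫ s in a..b, μ s * |f (X s)|)) := by
    simp only [← hfx, ← hfy]
    exact (f.continuous.tendsto y).comp hxy
  obtain ⟨φ, hφ, hwlim⟩ := exists_seq_tendsto_ae_sign_mul hab hμ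
    (f.continuous.comp_continuousOn hX) hfX0 hw hwμ hlim
  have hxlim := tendsto_integral_smul_of_abs_le hab hμ hX (fun k => hw (φ k))
    (fun k => hwμ (φ k)) hwlim
  simp only [← hxw, mul_smul] at hxlim
  exact tendsto_nhds_unique (hxy.comp hφ.tendsto_atTop) hxlim

theorem frontier_momentSet [FiniteDimensional ℝ E] (hab : a ≤ b) (hμ : ContinuousOn μ (Icc a b))
    (hμ0 : ∀ s ∈ Icc a b, 0 ≤ μ s) (hX : ContinuousOn X (Icc a b))
    (hX0 : ∀ f : E →L[ℝ] ℝ, f ≠ 0 → ∀ᵐ s ∂volume.restrict (Ioc a b), f (X s) ≠ 0) :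
    frontier (momentSet μ X a b) = bangBang μ X a b '' {0}ᶜ := by
  have := FiniteDimensional.complete ℝ E
  ext y
  constructor
  · intro hy
    obtain ⟨f, hf, hmax⟩ := exists_isMaxOn_closure_of_mem_frontier (convex_momentSet hab hX) hy
    exact ⟨f, hf, (eq_bangBang_of_isMaxOn hab hμ hμ0 hX (hX0 f hf) hy.1 hmax).symm⟩
  · rintro ⟨f, hf, rfl⟩
    exact ⟨bangBang_mem_closure hab hμ hμ0 hX f,
      notMem_interior_of_isMaxOn hf (isMaxOn_bangBang hab hμ hX f)⟩

end MomentSet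

section SignPattern

open Polynomial

theorem forall_pos_or_forall_neg_of_forall_ne_zero {α : Type*} [TopologicalSpace α] {S : Set α}
    (hS : IsPreconnected S) {f : α → ℝ} (hf : ContinuousOn f S) (hf0 : ∀ x ∈ S, f x ≠ 0) :
    (∀ x ∈ S, 0 < f x) ∨ ∀ x ∈ S, f x < 0 := by
  by_contra! ⟨⟨x, hx, hfx⟩, z, hz, hfz⟩
  obtain ⟨c, hc, hfc⟩ := hS.intermediate_value hx hz hf ⟨hfx, hfz⟩
  exact hf0 c hc hfc

-- Roots of `P` outside the interval are replaced by factors `b - s` of constant sign.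
theorem exists_sign_pattern {a b : ℝ} (hab : a ≤ b) {m : ℕ} {P : ℝ[X]} (hP : P ≠ 0)
    (hdeg : P.natDegree ≤ m) :
    ∃ σ : Fin m → ℝ, (∀ i, σ i ∈ Icc a b) ∧
      ((∀ s ∈ Icc a b, 0 ≤ P.eval s * ∏ i, (σ i - s)) ∨
        ∀ s ∈ Icc a b, P.eval s * ∏ i, (σ i - s) ≤ 0) := by
  induction m generalizing P with
  | zero =>
    rw [eq_C_of_natDegree_le_zero hdeg]
    exact ⟨Fin.elim0, fun i => i.elim0,
      (le_total 0 (P.coeff 0)).imp (fun h _ _ => by simpa using h) fun h _ _ => by simpa using h⟩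
  | succ m ih =>
    by_cases hroot : ∀ s ∈ Icc a b, P.eval s ≠ 0
    · have hprod : ∀ s ∈ Icc a b, 0 ≤ ∏ _i : Fin (m + 1), (b - s) := fun s hs =>
        Finset.prod_nonneg fun _ _ => sub_nonneg.2 hs.2
      refine ⟨fun _ => b, fun _ => right_mem_Icc.2 hab,
        (forall_pos_or_forall_neg_of_forall_ne_zero isPreconnected_Icc P.continuous.continuousOn
          hroot).imp (fun h s hs => ?_) fun h s hs => ?_⟩
      · exact mul_nonneg (h s hs).le (hprod s hs)
      · exact mul_nonpos_of_nonpos_of_nonneg (h s hs).le (hprod s hs)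
    · push Not at hroot
      obtain ⟨x, hx, hPx⟩ := hroot
      obtain ⟨Q, rfl⟩ := dvd_iff_isRoot.2 hPx
      have hQ : Q ≠ 0 := right_ne_zero_of_mul hP
      rw [natDegree_mul (X_sub_C_ne_zero x) hQ, natDegree_X_sub_C] at hdeg
      obtain ⟨σ, hσ, hsign⟩ := ih hQ (by lia)
      refine ⟨Fin.cons x σ, Fin.cases hx hσ, hsign.symm.imp (fun h s hs => ?_) fun h s hs => ?_⟩
      all_goals
        have hsq := mul_le_mul_of_nonneg_right (h s hs) (sq_nonneg (x - s))
        simp only [Fin.prod_univ_succ, Fin.cons_zero, Fin.cons_succ, eval_mul, eval_sub, eval_X,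
          eval_C]
        linarith

theorem exists_mem_weylChamber_sign_pattern {t : ℝ} (ht : 0 ≤ t) {m : ℕ} {P : ℝ[X]} (hP : P ≠ 0)
    (hdeg : P.natDegree ≤ m) :
    ∃ σ ∈ weylChamber m t, (∀ s ∈ Icc 0 t, 0 ≤ P.eval s * ∏ i, (σ i - s)) ∨
      ∀ s ∈ Icc 0 t, P.eval s * ∏ i, (σ i - s) ≤ 0 := by
  obtain ⟨σ, hσ, hsign⟩ := exists_sign_pattern ht hP hdeg
  have hprod : ∀ s, ∏ i, ((σ ∘ Tuple.sort σ) i - s) = ∏ i, (σ i - s) := fun s =>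
    Equiv.prod_comp (Tuple.sort σ) fun i => σ i - s
  exact ⟨σ ∘ Tuple.sort σ, ⟨Tuple.monotone_sort σ, fun i => hσ _⟩,
    by simpa only [hprod] using hsign⟩

theorem ae_eval_ne_zero {P : ℝ[X]} (hP : P ≠ 0) : ∀ᵐ s : ℝ, P.eval s ≠ 0 :=
  (finite_setOfPred_isRoot hP).countable.ae_notMem volume

theorem sign_eq_sign_of_mul_pos {x y : ℝ} (hxy : 0 < x * y) :
    SignType.sign x = SignType.sign y := by
  rcases mul_pos_iff.1 hxy with ⟨hx, hy⟩ | ⟨hx, hy⟩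
  · rw [sign_pos hx, sign_pos hy]
  · rw [sign_neg hx, sign_neg hy]

theorem ae_sign_eval_eq {P Q : ℝ[X]} (hP : P ≠ 0) (hQ : Q ≠ 0) {S : Set ℝ}
    (hPQ : ∀ s ∈ S, 0 ≤ P.eval s * Q.eval s) :
    ∀ᵐ s : ℝ, s ∈ S → SignType.sign (P.eval s) = SignType.sign (Q.eval s) := by
  filter_upwards [ae_eval_ne_zero hP, ae_eval_ne_zero hQ] with s hPs hQs hs
  exact sign_eq_sign_of_mul_pos ((hPQ s hs).lt_of_ne' (mul_ne_zero hPs hQs))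

end SignPattern

section SwitchingFunction

open Polynomial

variable {m : ℕ}

theorem continuous_xi (m : ℕ) : Continuous (xi m) := by
  unfold xi
  fun_prop

theorem xi_rev (s : ℝ) (i : Fin (m + 1)) :
    xi m s i.rev = s ^ (i : ℕ) / ((i : ℕ).factorial : ℝ) := by
  have hi : m - (i.rev : ℕ) = i := by rw [Fin.val_rev]; lia
  rw [xi, hi]

theorem apply_eq_sum_single_rev (f : (Fin (m + 1) → ℝ) →L[ℝ] ℝ) (x : Fin (m + 1) → ℝ) :
    f x = ∑ i : Fin (m + 1), x i.rev * f (Pi.single i.rev 1) := by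
  have hsum : f x = ∑ i, x i * f (Pi.single i 1) := by
    conv_lhs => rw [pi_eq_sum_univ' x]
    simp only [map_sum, map_smul, smul_eq_mul]
  exact hsum.trans (Equiv.sum_comp Fin.revPerm fun i => x i * f (Pi.single i 1)).symm

theorem exists_eval_eq_apply_xi {f : (Fin (m + 1) → ℝ) →L[ℝ] ℝ} (hf : f ≠ 0) :
    ∃ P : ℝ[X], P ≠ 0 ∧ P.natDegree ≤ m ∧ ∀ s, P.eval s = f (xi m s) := by
  let c : Fin (m + 1) → ℝ := fun i => f (Pi.single i.rev 1) / ((i : ℕ).factorial : ℝ)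
  let P := (degreeLTEquiv ℝ (m + 1)).symm c
  refine ⟨P, fun hP => hf ?_, ?_, fun s => ?_⟩
  · have hc : c = 0 := by
      rwa [ZeroMemClass.coe_eq_zero, LinearEquiv.map_eq_zero_iff] at hP
    have hsingle : ∀ i : Fin (m + 1), f (Pi.single i.rev 1) = 0 := fun i => by
      simpa [c, Nat.factorial_ne_zero] using congrFun hc i
    ext x
    rw [apply_eq_sum_single_rev f x]
    simp only [hsingle, mul_zero, Finset.sum_const_zero, zero_apply]
  · exact natDegree_le_of_degree_le (mem_degreeLE.1 (degreeLT_succ_eq_degreeLE (R := ℝ) ▸ P.2))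
  · rw [eval_eq_sum_degreeLTEquiv P.2, apply_eq_sum_single_rev f]
    refine Finset.sum_congr rfl fun i _ => ?_
    simp only [P, Subtype.coe_eta, LinearEquiv.apply_symm_apply, c, xi_rev]
    ring

theorem exists_apply_xi_eq_eval {P : ℝ[X]} (hP : P ≠ 0) (hdeg : P.natDegree ≤ m) :
    ∃ f : (Fin (m + 1) → ℝ) →L[ℝ] ℝ, f ≠ 0 ∧ ∀ s, f (xi m s) = P.eval s := by
  let f : (Fin (m + 1) → ℝ) →L[ℝ] ℝ := ∑ i : Fin (m + 1),
    (P.coeff i * ((i : ℕ).factorial : ℝ)) • ContinuousLinearMap.proj i.rev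
  have hfP : ∀ s, f (xi m s) = P.eval s := fun s => by
    rw [eval_eq_sum_range' (Nat.lt_succ_of_le hdeg), Finset.sum_range]
    simp only [f, sum_apply, smul_apply, ContinuousLinearMap.proj_apply, smul_eq_mul, xi_rev]
    refine Finset.sum_congr rfl fun i _ => ?_
    field_simp
  refine ⟨f, fun hf => hP (Polynomial.funext fun s => ?_), hfP⟩
  rw [← hfP, hf, zero_apply, eval_zero]

theorem comp_C_sub_X_ne_zero {P : ℝ[X]} (hP : P ≠ 0) (t : ℝ) : P.comp (C t - X) ≠ 0 := fun h =>
  hP (Polynomial.funext fun s => by simpa using congrArg (eval (t - s)) h)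

theorem natDegree_comp_C_sub_X_le (P : ℝ[X]) (t : ℝ) :
    (P.comp (C t - X)).natDegree ≤ P.natDegree := by
  have hlin : (C t - X : ℝ[X]).natDegree ≤ 1 := by compute_degree
  simpa using natDegree_comp_le.trans (Nat.mul_le_mul_left P.natDegree hlin)

theorem exists_eval_eq_apply_xi_sub {f : (Fin (m + 1) → ℝ) →L[ℝ] ℝ} (hf : f ≠ 0) (t : ℝ) :
    ∃ P : ℝ[X], P ≠ 0 ∧ P.natDegree ≤ m ∧ ∀ s, P.eval s = f (xi m (t - s)) := by
  obtain ⟨P, hP, hdeg, hPf⟩ := exists_eval_eq_apply_xi hf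
  exact ⟨P.comp (C t - X), comp_C_sub_X_ne_zero hP t, (natDegree_comp_C_sub_X_le P t).trans hdeg,
    fun s => by simp [hPf]⟩

theorem exists_apply_xi_sub_eq_eval {P : ℝ[X]} (hP : P ≠ 0) (hdeg : P.natDegree ≤ m) (t : ℝ) :
    ∃ f : (Fin (m + 1) → ℝ) →L[ℝ] ℝ, f ≠ 0 ∧ ∀ s, f (xi m (t - s)) = P.eval s := by
  obtain ⟨f, hf, hfP⟩ := exists_apply_xi_eq_eval (comp_C_sub_X_ne_zero hP t)
    ((natDegree_comp_C_sub_X_le P t).trans hdeg)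
  exact ⟨f, hf, fun s => by simp [hfP]⟩

end SwitchingFunction

section Alternating

variable {m : ℕ} {t : ℝ} {σ : Fin m → ℝ} {μ : ℝ → ℝ}

theorem monotone_snoc {α : Type*} [Preorder α] {f : Fin m → α} {c : α} (hf : Monotone f)
    (hfc : ∀ i, f i ≤ c) : Monotone (Fin.snoc f c : Fin (m + 1) → α) := by
  intro i j hij
  induction j using Fin.lastCases with
  | last =>
    induction i using Fin.lastCases with
    | last => rfl
    | cast i => simpa using hfc i
  | cast j =>
    induction i using Fin.lastCases with
    | last => exact absurd hij (not_le.2 (Fin.castSucc_lt_last j))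
    | cast i => simpa using hf (Fin.castSucc_le_castSucc_iff.1 hij)

theorem monotone_nodes (ht : 0 ≤ t) (hσ : σ ∈ weylChamber m t) : Monotone (nodes t σ) := by
  have hnonneg : ∀ i : Fin (m + 1), 0 ≤ (Fin.snoc σ t : Fin (m + 1) → ℝ) i :=
    Fin.lastCases (by simpa using ht) fun i => by simpa using (hσ.2 i).1
  exact (monotone_snoc hσ.1 fun i => (hσ.2 i).2).vecCons (hnonneg 0)

theorem nodes_last (t : ℝ) (σ : Fin m → ℝ) : nodes t σ (Fin.last (m + 1)) = t := by
  rw [← Fin.succ_last, nodes, Fin.cons_succ, Fin.snoc_last]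

theorem nodes_succ_castSucc (t : ℝ) (σ : Fin m → ℝ) (i : Fin m) :
    nodes t σ i.castSucc.succ = σ i := by
  rw [nodes, Fin.cons_succ, Fin.snoc_castSucc]

theorem nodes_mem_Icc (ht : 0 ≤ t) (hσ : σ ∈ weylChamber m t) (k : Fin (m + 2)) :
    nodes t σ k ∈ Icc 0 t :=
  ⟨monotone_nodes ht hσ (Fin.zero_le k),
    (monotone_nodes ht hσ (Fin.le_last k)).trans_eq (nodes_last t σ)⟩

theorem sign_prod_sub_eq_neg_one_pow (ht : 0 ≤ t) (hσ : σ ∈ weylChamber m t) {k : Fin (m + 1)}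
    {s : ℝ} (hs : s ∈ Ioo (nodes t σ k.castSucc) (nodes t σ k.succ)) :
    SignType.sign (∏ i, (σ i - s)) = (-1) ^ (k : ℕ) := by
  have hsign : ∀ i : Fin m, SignType.sign (σ i - s) = if (i : ℕ) < k then -1 else 1 := fun i => by
    rw [← nodes_succ_castSucc t σ i]
    split_ifs with hik
    · refine sign_neg (sub_neg.2 (hs.1.trans_le' (monotone_nodes ht hσ ?_)))
      exact Fin.le_def.2 (by simpa using hik)
    · refine sign_pos (sub_pos.2 (hs.2.trans_le (monotone_nodes ht hσ ?_)))
      exact Fin.succ_le_succ_iff.2 (Fin.le_def.2 (by simpa using hik))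
  calc SignType.sign (∏ i, (σ i - s)) = ∏ i, SignType.sign (σ i - s) := map_prod signHom _ _
    _ = ∏ i : Fin m, if (i : ℕ) < k then (-1 : SignType) else 1 := by simp only [hsign]
    _ = (-1) ^ (k : ℕ) := by
      rw [Finset.prod_ite, Finset.prod_const_one, mul_one, Finset.prod_const,
        Fin.card_filter_val_lt, min_eq_right (Nat.lt_succ_iff.1 k.isLt)]

theorem sum_integral_castSucc_succ {E : Type*} [NormedAddCommGroup E] [NormedSpace ℝ E]
    {g : ℝ → E} {ν : Measure ℝ} {n : ℕ} {a : Fin (n + 1) → ℝ}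
    (hg : ∀ k : Fin n, IntervalIntegrable g ν (a k.castSucc) (a k.succ)) :
    ∑ k : Fin n, ∫ s in a k.castSucc..a k.succ, g s ∂ν = ∫ s in a 0..a (Fin.last n), g s ∂ν := by
  have hcast : ∀ k : Fin n, Fin.ofNat (n + 1) k = k.castSucc := fun k =>
    Fin.ext (Nat.mod_eq_of_lt (by lia))
  have hsucc : ∀ k : Fin n, Fin.ofNat (n + 1) (k + 1) = k.succ := fun k =>
    Fin.ext (Nat.mod_eq_of_lt (by lia))
  have hlast : Fin.ofNat (n + 1) n = Fin.last n := Fin.ext (Nat.mod_eq_of_lt n.lt_succ_self)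
  have hsum := intervalIntegral.sum_integral_adjacent_intervals (f := g) (μ := ν) (n := n)
    (a := fun k => a (Fin.ofNat (n + 1) k))
    fun k hk => by simpa only [hcast ⟨k, hk⟩, hsucc ⟨k, hk⟩] using hg ⟨k, hk⟩
  simpa only [Finset.sum_range, hcast, hsucc, hlast, Fin.ofNat_zero] using hsum

theorem alternating_eq_integral_sign (ht : 0 ≤ t) (hσ : σ ∈ weylChamber m t)
    (hμ : ContinuousOn μ (Icc 0 t)) :
    alternating μ t σ =
      ∫ s in (0 : ℝ)..t, (SignType.sign (∏ i, (σ i - s)) : ℝ) • μ s • xi m (t - s) := by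
  have hmono := monotone_nodes ht hσ
  have hcont : ContinuousOn (fun s => μ s • xi m (t - s)) (Icc 0 t) :=
    hμ.smul ((continuous_xi m).comp (continuous_const.sub continuous_id)).continuousOn
  have hint : ∀ k : Fin (m + 1), IntervalIntegrable
      (fun s => (SignType.sign (∏ i, (σ i - s)) : ℝ) • μ s • xi m (t - s)) volume
      (nodes t σ k.castSucc) (nodes t σ k.succ) := fun k =>
    intervalIntegrable_sign_smul (hmono (Fin.castSucc_le_succ k)) (by fun_prop)
      (hcont.mono (Icc_subset_Icc (nodes_mem_Icc ht hσ _).1 (nodes_mem_Icc ht hσ _).2))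
  have hsum := sum_integral_castSucc_succ hint
  rw [nodes_last] at hsum
  refine Eq.trans (Finset.sum_congr rfl fun k _ => ?_) hsum
  rw [← intervalIntegral.integral_smul]
  refine intervalIntegral.integral_congr_Ioo_of_le (hmono (Fin.castSucc_le_succ k)) fun s hs => ?_
  simp [sign_prod_sub_eq_neg_one_pow ht hσ hs]

end Alternating

section IntegratorMoments

open Polynomial

variable {m : ℕ} {t : ℝ} {σ : Fin m → ℝ} {μ : ℝ → ℝ}

theorem eval_prod_C_sub_X (σ : Fin m → ℝ) (s : ℝ) :
    (∏ i, (C (σ i) - X)).eval s = ∏ i, (σ i - s) := by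
  simp only [eval_prod, eval_sub, eval_C, eval_X]

theorem prod_C_sub_X_ne_zero (σ : Fin m → ℝ) : ∏ i, (C (σ i) - X) ≠ 0 :=
  Finset.prod_ne_zero_iff.2 fun i _ => sub_ne_zero.2 (X_ne_C (σ i)).symm

theorem natDegree_prod_C_sub_X_le (σ : Fin m → ℝ) : (∏ i, (C (σ i) - X)).natDegree ≤ m := by
  have hlin : ∀ i, (C (σ i) - X).natDegree ≤ 1 := fun i => by compute_degree
  simpa using (natDegree_prod_le Finset.univ _).trans
    (Finset.sum_le_card_nsmul _ _ 1 fun i _ => hlin i)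

theorem bangBang_neg {E : Type*} [NormedAddCommGroup E] [NormedSpace ℝ E] (μ : ℝ → ℝ) (X : ℝ → E)
    (a b : ℝ) (f : E →L[ℝ] ℝ) : bangBang μ X a b (-f) = -bangBang μ X a b f := by
  simp only [bangBang, neg_apply, Left.sign_neg, SignType.coe_neg, neg_smul,
    intervalIntegral.integral_neg]

theorem bangBang_xi_eq_alternating (ht : 0 ≤ t) (hμ : ContinuousOn μ (Icc 0 t))
    (hσ : σ ∈ weylChamber m t) {f : (Fin (m + 1) → ℝ) →L[ℝ] ℝ} (hf : f ≠ 0)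
    (hsign : ∀ s ∈ Icc 0 t, 0 ≤ f (xi m (t - s)) * ∏ i, (σ i - s)) :
    bangBang μ (fun s => xi m (t - s)) 0 t f = alternating μ t σ := by
  obtain ⟨P, hP, -, hPf⟩ := exists_eval_eq_apply_xi_sub hf t
  have hae := ae_sign_eval_eq (S := Icc 0 t) hP (prod_C_sub_X_ne_zero σ) fun s hs => by
    rw [hPf, eval_prod_C_sub_X]
    exact hsign s hs
  rw [alternating_eq_integral_sign ht hσ hμ]
  refine intervalIntegral.integral_congr_ae (hae.mono fun s hs hst => ?_)
  rw [uIoc_of_le ht] at hst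
  rw [← hPf, ← eval_prod_C_sub_X, hs (Ioc_subset_Icc_self hst)]

theorem exists_bangBang_xi_eq_alternating (ht : 0 ≤ t) (hμ : ContinuousOn μ (Icc 0 t))
    (hσ : σ ∈ weylChamber m t) :
    ∃ f : (Fin (m + 1) → ℝ) →L[ℝ] ℝ, f ≠ 0 ∧
      bangBang μ (fun s => xi m (t - s)) 0 t f = alternating μ t σ := by
  obtain ⟨f, hf, hfP⟩ :=
    exists_apply_xi_sub_eq_eval (prod_C_sub_X_ne_zero σ) (natDegree_prod_C_sub_X_le σ) t
  refine ⟨f, hf, bangBang_xi_eq_alternating ht hμ hσ hf fun s _ => ?_⟩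
  rw [hfP, eval_prod_C_sub_X]
  exact mul_self_nonneg _

theorem exists_bangBang_xi_eq_alternating_or_neg (ht : 0 ≤ t) (hμ : ContinuousOn μ (Icc 0 t))
    {f : (Fin (m + 1) → ℝ) →L[ℝ] ℝ} (hf : f ≠ 0) :
    ∃ σ ∈ weylChamber m t, bangBang μ (fun s => xi m (t - s)) 0 t f = alternating μ t σ ∨
      bangBang μ (fun s => xi m (t - s)) 0 t f = -alternating μ t σ := by
  obtain ⟨P, hP, hdeg, hPf⟩ := exists_eval_eq_apply_xi_sub hf t
  obtain ⟨σ, hσ, hsign⟩ := exists_mem_weylChamber_sign_pattern ht hP hdeg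
  simp only [hPf] at hsign
  refine ⟨σ, hσ, hsign.imp (bangBang_xi_eq_alternating ht hμ hσ hf) fun hneg => ?_⟩
  rw [← neg_eq_iff_eq_neg, ← bangBang_neg]
  refine bangBang_xi_eq_alternating ht hμ hσ (neg_ne_zero.2 hf) fun s hs => ?_
  simpa only [neg_apply, neg_mul, neg_nonneg] using hneg s hs

theorem ae_apply_xi_sub_ne_zero {f : (Fin (m + 1) → ℝ) →L[ℝ] ℝ} (hf : f ≠ 0) (t : ℝ) :
    ∀ᵐ s : ℝ, f (xi m (t - s)) ≠ 0 := by
  obtain ⟨P, hP, -, hPf⟩ := exists_eval_eq_apply_xi_sub hf t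
  simpa only [hPf] using ae_eval_ne_zero hP

theorem frontier_momentSet_xi (ht : 0 ≤ t) (hμ : ContinuousOn μ (Icc 0 t))
    (hμ0 : ∀ s ∈ Icc 0 t, 0 ≤ μ s) :
    frontier (momentSet μ (fun s => xi m (t - s)) 0 t) =
      alternating μ t '' weylChamber m t ∪ (fun σ => -alternating μ t σ) '' weylChamber m t := by
  have hξ : ContinuousOn (fun s => xi m (t - s)) (Icc 0 t) :=
    ((continuous_xi m).comp (continuous_const.sub continuous_id)).continuousOn
  rw [frontier_momentSet ht hμ hμ0 hξ fun f hf => ae_restrict_of_ae (ae_apply_xi_sub_ne_zero hf t)]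
  refine Subset.antisymm ?_ (union_subset ?_ ?_)
  · rintro _ ⟨f, hf, rfl⟩
    obtain ⟨σ, hσ, h | h⟩ := exists_bangBang_xi_eq_alternating_or_neg ht hμ hf
    exacts [.inl ⟨σ, hσ, h.symm⟩, .inr ⟨σ, hσ, h.symm⟩]
  · rintro _ ⟨σ, hσ, rfl⟩
    exact exists_bangBang_xi_eq_alternating ht hμ hσ
  · rintro _ ⟨σ, hσ, rfl⟩
    obtain ⟨f, hf, hfσ⟩ := exists_bangBang_xi_eq_alternating ht hμ hσ
    exact ⟨-f, neg_ne_zero.2 hf, by rw [bangBang_neg, hfσ]⟩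

end IntegratorMoments

section VariationOfConstants

attribute [local instance] Matrix.linftyOpNormedRing Matrix.linftyOpNormedAlgebra

variable {ι : Type*} [Fintype ι] [DecidableEq ι] (F : Matrix ι ι ℝ)

theorem hasSum_exp_smul_apply (r : ℝ) (i j : ι) :
    HasSum (fun k : ℕ => r ^ k / (k.factorial : ℝ) * (F ^ k) i j)
      (NormedSpace.exp (r • F) i j) := by
  have hsum := NormedSpace.exp_series_hasSum_exp' (𝕂 := ℝ) (r • F)
  refine (Pi.hasSum.1 (Pi.hasSum.1 hsum i) j).congr_fun fun k => ?_
  simp only [smul_pow, Matrix.smul_apply, smul_eq_mul]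
  ring

theorem hasDerivAt_exp_smul_matrix (r : ℝ) :
    HasDerivAt (fun r : ℝ => NormedSpace.exp (r • F)) (NormedSpace.exp (r • F) * F) r :=
  hasDerivAt_exp_smul_const F r

theorem exp_smul_mulVec_exp_neg_smul_mulVec (r : ℝ) (x : ι → ℝ) :
    NormedSpace.exp (r • F) *ᵥ (NormedSpace.exp ((-r) • F) *ᵥ x) = x := by
  rw [Matrix.mulVec_mulVec, ← Matrix.exp_add_of_commute _ _
    (((Commute.refl F).smul_left r).smul_right (-r)), ← add_smul, add_neg_cancel, zero_smul,
    NormedSpace.exp_zero, Matrix.one_mulVec]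

theorem exp_smul_mulVec_mulVec_comm (r : ℝ) (x : ι → ℝ) :
    NormedSpace.exp (r • F) *ᵥ (F *ᵥ x) = F *ᵥ (NormedSpace.exp (r • F) *ᵥ x) := by
  rw [Matrix.mulVec_mulVec, Matrix.mulVec_mulVec,
    (((Commute.refl F).smul_left r).exp_left).eq]

theorem hasDerivWithinAt_exp_smul_mulVec {φ : ℝ → ℝ} {φ' s : ℝ} {x : ℝ → ι → ℝ} {x' : ι → ℝ}
    {S : Set ℝ} (hφ : HasDerivWithinAt φ φ' S s) (hx : HasDerivWithinAt x x' S s) :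
    HasDerivWithinAt (fun r => NormedSpace.exp (φ r • F) *ᵥ x r)
      (NormedSpace.exp (φ s • F) *ᵥ (φ' • F *ᵥ x s + x')) S s := by
  let B := (Matrix.mulVecBilin ℝ ℝ : Matrix ι ι ℝ →ₗ[ℝ] (ι → ℝ) →ₗ[ℝ] ι → ℝ)
  have hexp := (hasDerivAt_exp_smul_matrix F (φ s)).scomp_hasDerivWithinAt s hφ
  refine (B.toContinuousBilinearMap.hasDerivWithinAt_of_bilinear hexp hx).congr_deriv ?_
  change NormedSpace.exp (φ s • F) *ᵥ x' + (φ' • (NormedSpace.exp (φ s • F) * F)) *ᵥ x s = _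
  rw [Matrix.mulVec_add, Matrix.mulVec_smul, Matrix.smul_mulVec, Matrix.mulVec_mulVec, add_comm]

theorem continuous_exp_smul_mulVec (x : ι → ℝ) :
    Continuous fun r : ℝ => NormedSpace.exp (r • F) *ᵥ x := by
  have hexp : Continuous fun r : ℝ => NormedSpace.exp (r • F) :=
    continuous_iff_continuousAt.2 fun r => (hasDerivAt_exp_smul_matrix F r).continuousAt
  exact hexp.matrix_mulVec continuous_const

theorem hasDerivWithinAt_integral_of_continuousOn {E : Type*} [NormedAddCommGroup E]
    [NormedSpace ℝ E] [CompleteSpace E] {h : ℝ → E} {a b s : ℝ} (hh : ContinuousOn h (Icc a b))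
    (hs : s ∈ Icc a b) :
    HasDerivWithinAt (fun r => ∫ τ in a..r, h τ) (h s) (Icc a b) s := by
  have : Fact (s ∈ Icc a b) := ⟨hs⟩
  exact intervalIntegral.integral_hasDerivWithinAt_right
    ((hh.mono (Icc_subset_Icc_right hs.2)).intervalIntegrable_of_Icc hs.1)
    (hh.stronglyMeasurableAtFilter_nhdsWithin measurableSet_Icc s) (hh s hs)

variable {F} {g : ι → ℝ} {t : ℝ} {u : ℝ → ℝ}

theorem exists_hasDerivWithinAt_mulVec_add_smul {κ : Type*} [Fintype κ] (F : Matrix κ κ ℝ)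
    (g x₀ : κ → ℝ) (hu : ContinuousOn u (Icc 0 t)) :
    ∃ x : ℝ → κ → ℝ, x 0 = x₀ ∧
      ∀ s ∈ Icc 0 t, HasDerivWithinAt x (F *ᵥ x s + u s • g) (Icc 0 t) s := by
  classical
  let h : ℝ → κ → ℝ := fun r => u r • NormedSpace.exp ((-r) • F) *ᵥ g
  have hh : ContinuousOn h (Icc 0 t) :=
    hu.smul ((continuous_exp_smul_mulVec F g).comp continuous_neg).continuousOn
  refine ⟨fun s => NormedSpace.exp (s • F) *ᵥ (x₀ + ∫ r in (0 : ℝ)..s, h r), by simp,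
    fun s hs => ?_⟩
  refine (hasDerivWithinAt_exp_smul_mulVec F (hasDerivWithinAt_id s _)
    ((hasDerivWithinAt_integral_of_continuousOn hh hs).const_add x₀)).congr_deriv ?_
  simp only [id, h, one_smul, Matrix.mulVec_add, Matrix.mulVec_smul,
    exp_smul_mulVec_mulVec_comm, exp_smul_mulVec_exp_neg_smul_mulVec]

theorem eq_exp_mulVec_add_integral (ht : 0 ≤ t) (hu : ContinuousOn u (Icc 0 t)) {x : ℝ → ι → ℝ}
    (hx : ∀ s ∈ Icc 0 t, HasDerivWithinAt x (F *ᵥ x s + u s • g) (Icc 0 t) s) :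
    x t = NormedSpace.exp (t • F) *ᵥ x 0 +
      ∫ s in (0 : ℝ)..t, u s • NormedSpace.exp ((t - s) • F) *ᵥ g := by
  have hderiv : ∀ s ∈ Icc 0 t, HasDerivWithinAt (fun s => NormedSpace.exp ((t - s) • F) *ᵥ x s)
      (u s • NormedSpace.exp ((t - s) • F) *ᵥ g) (Icc 0 t) s := fun s hs => by
    refine (hasDerivWithinAt_exp_smul_mulVec F ((hasDerivWithinAt_id s _).const_sub t)
      (hx s hs)).congr_deriv ?_
    rw [neg_one_smul, neg_add_cancel_left, Matrix.mulVec_smul, id]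
  have hcont : ContinuousOn (fun s => u s • NormedSpace.exp ((t - s) • F) *ᵥ g) (Icc 0 t) :=
    hu.smul ((continuous_exp_smul_mulVec F g).comp (continuous_const.sub
      continuous_id)).continuousOn
  rw [intervalIntegral.integral_eq_sub_of_hasDerivAt_of_le ht
    (fun s hs => (hderiv s hs).continuousWithinAt)
    (fun s hs => (hderiv s (Ioo_subset_Icc_self hs)).hasDerivAt (Icc_mem_nhds hs.1 hs.2))
    (hcont.intervalIntegrable_of_Icc ht)]
  simp

end VariationOfConstants

section ReachSet

variable {m : ℕ} {F : Matrix (Fin (m + 1)) (Fin (m + 1)) ℝ} {g : Fin (m + 1) → ℝ}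
  {lo hi : ℝ → ℝ} {t : ℝ}

theorem mem_reachSet_iff (ht : 0 ≤ t) {x₀ y : Fin (m + 1) → ℝ} :
    y ∈ reachSet F g lo hi t x₀ ↔ ∃ u : ℝ → ℝ, ContinuousOn u (Icc 0 t) ∧
      (∀ s ∈ Icc 0 t, u s ∈ Icc (lo s) (hi s)) ∧
      y = NormedSpace.exp (t • F) *ᵥ x₀ +
        ∫ s in (0 : ℝ)..t, u s • NormedSpace.exp ((t - s) • F) *ᵥ g := by
  constructor
  · rintro ⟨u, x, hu, hb, rfl, hx, rfl⟩
    exact ⟨u, hu, hb, eq_exp_mulVec_add_integral ht hu hx⟩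
  · rintro ⟨u, hu, hb, rfl⟩
    obtain ⟨x, rfl, hx⟩ := exists_hasDerivWithinAt_mulVec_add_smul F g x₀ hu
    exact ⟨u, x, hu, hb, rfl, hx, (eq_exp_mulVec_add_integral ht hu hx).symm⟩

theorem abs_sub_midpt_le_halfWidth_iff {s v : ℝ} :
    |v - midpt lo hi s| ≤ halfWidth lo hi s ↔ v ∈ Icc (lo s) (hi s) := by
  rw [abs_le, midpt, halfWidth, mem_Icc]
  constructor <;> rintro ⟨hl, hr⟩ <;> constructor <;> linarith

theorem continuousOn_midpt {S : Set ℝ} (hlo : ContinuousOn lo S) (hhi : ContinuousOn hi S) :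
    ContinuousOn (midpt lo hi) S :=
  (hhi.add hlo).div_const 2

theorem continuousOn_halfWidth {S : Set ℝ} (hlo : ContinuousOn lo S) (hhi : ContinuousOn hi S) :
    ContinuousOn (halfWidth lo hi) S :=
  (hhi.sub hlo).div_const 2

theorem reachSet_eq_image_momentSet (ht : 0 ≤ t) (hlo : ContinuousOn lo (Icc 0 t))
    (hhi : ContinuousOn hi (Icc 0 t)) (x₀ : Fin (m + 1) → ℝ) :
    reachSet F g lo hi t x₀ =
      Homeomorph.addLeft (NormedSpace.exp (t • F) *ᵥ x₀ +
        ∫ s in (0 : ℝ)..t, midpt lo hi s • NormedSpace.exp ((t - s) • F) *ᵥ g) ''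
      momentSet (halfWidth lo hi) (fun s => NormedSpace.exp ((t - s) • F) *ᵥ g) 0 t := by
  have hmid := continuousOn_midpt hlo hhi
  have hX : ContinuousOn (fun s => NormedSpace.exp ((t - s) • F) *ᵥ g) (Icc 0 t) :=
    ((continuous_exp_smul_mulVec F g).comp (continuous_const.sub continuous_id)).continuousOn
  have hsplit : ∀ w : ℝ → ℝ, ContinuousOn w (Icc 0 t) →
      ∫ s in (0 : ℝ)..t, (midpt lo hi s + w s) • NormedSpace.exp ((t - s) • F) *ᵥ g =
        (∫ s in (0 : ℝ)..t, midpt lo hi s • NormedSpace.exp ((t - s) • F) *ᵥ g) +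
          ∫ s in (0 : ℝ)..t, w s • NormedSpace.exp ((t - s) • F) *ᵥ g := fun w hw => by
    simp only [add_smul]
    exact intervalIntegral.integral_add ((hmid.smul hX).intervalIntegrable_of_Icc ht)
      ((hw.smul hX).intervalIntegrable_of_Icc ht)
  ext y
  rw [mem_reachSet_iff ht]
  constructor
  · rintro ⟨u, hu, hb, rfl⟩
    refine ⟨_, ⟨fun s => u s - midpt lo hi s, hu.sub hmid,
      fun s hs => abs_sub_midpt_le_halfWidth_iff.2 (hb s hs), rfl⟩, ?_⟩
    have hu_split := hsplit _ (hu.sub hmid)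
    simp only [Pi.sub_apply, add_sub_cancel] at hu_split
    simp only [Homeomorph.coe_addLeft, add_assoc, hu_split]
  · rintro ⟨_, ⟨w, hw, hwμ, rfl⟩, rfl⟩
    refine ⟨fun s => midpt lo hi s + w s, hmid.add hw,
      fun s hs => abs_sub_midpt_le_halfWidth_iff.1 ?_, ?_⟩
    · simpa only [add_sub_cancel_left] using hwμ s hs
    · simp only [Homeomorph.coe_addLeft, add_assoc, hsplit w hw]

end ReachSet

section Integrator

variable {m : ℕ}

theorem Aint_apply (i j : Fin (m + 1)) : Aint m i j = if (j : ℕ) = i + 1 then 1 else 0 := rfl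

theorem Aint_pow_apply (k : ℕ) (i j : Fin (m + 1)) :
    (Aint m ^ k) i j = if (j : ℕ) = i + k then 1 else 0 := by
  induction k generalizing j with
  | zero => simp [Matrix.one_apply, Fin.ext_iff, eq_comm]
  | succ k ih =>
    rw [pow_succ, Matrix.mul_apply]
    simp only [ih, Aint_apply, ite_mul, one_mul, zero_mul]
    rw [← Finset.sum_filter]
    split_ifs with hj
    · have hk : (i : ℕ) + k < m + 1 := by lia
      rw [Finset.sum_eq_single ⟨i + k, hk⟩] <;> grind
    · exact Finset.sum_eq_zero (by grind)

theorem exp_smul_Aint_apply (s : ℝ) (i j : Fin (m + 1)) :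
    NormedSpace.exp (s • Aint m) i j =
      if i ≤ j then s ^ ((j : ℕ) - i) / (((j : ℕ) - i).factorial : ℝ) else 0 := by
  have hsum := hasSum_exp_smul_apply (Aint m) s i j
  simp only [Aint_pow_apply, mul_ite, mul_one, mul_zero] at hsum
  split_ifs with hij
  · have hk : ∀ k : ℕ, (j : ℕ) = i + k ↔ k = j - i := fun k => by lia
    simp only [hk] at hsum
    refine hsum.unique ((hasSum_ite_eq ((j : ℕ) - i) _).congr_fun fun k => ?_)
    split_ifs with h
    exacts [by rw [h], rfl]
  · exact hsum.unique (hasSum_zero.congr_fun fun k => if_neg (by lia))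

theorem chi_eq_exp_mulVec (s : ℝ) (x : Fin (m + 1) → ℝ) :
    chi s x = NormedSpace.exp (s • Aint m) *ᵥ x := by
  ext k
  simp only [chi, Matrix.mulVec, dotProduct, exp_smul_Aint_apply, ite_mul, zero_mul]

theorem xi_eq_exp_mulVec (s : ℝ) :
    xi m s = NormedSpace.exp (s • Aint m) *ᵥ Pi.single (Fin.last m) 1 := by
  ext k
  simp [xi, exp_smul_Aint_apply, Fin.le_last]

theorem frontier_reachSet_integrator {lo hi : ℝ → ℝ} {t : ℝ} (ht : 0 ≤ t)
    (hlo : ContinuousOn lo (Icc 0 t)) (hhi : ContinuousOn hi (Icc 0 t))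
    (hle : ∀ s ∈ Icc 0 t, lo s ≤ hi s) (x₀ : Fin (m + 1) → ℝ) :
    frontier (reachSet (Aint m) (Pi.single (Fin.last m) 1) lo hi t x₀) =
      upperSurface lo hi t x₀ ∪ lowerSurface lo hi t x₀ := by
  have hwidth : ∀ s ∈ Icc 0 t, 0 ≤ halfWidth lo hi s := fun s hs =>
    div_nonneg (sub_nonneg.2 (hle s hs)) zero_le_two
  rw [reachSet_eq_image_momentSet ht hlo hhi, ← Homeomorph.image_frontier]
  simp only [← xi_eq_exp_mulVec]
  rw [frontier_momentSet_xi ht (continuousOn_halfWidth hlo hhi) hwidth, image_union, image_image,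
    image_image, ← chi_eq_exp_mulVec]
  simp only [Homeomorph.coe_addLeft, ← sub_eq_add_neg]
  rfl

end Integrator

section EndpointFunctional

variable {f : ℝ → ℝ} {a b p q : ℝ}

/-- The values `v(b) - ∫ f v` over the continuous `v` on `[a, b]` with `p ≤ v ≤ q`, as in `valuesI`
but for an arbitrary kernel `f`. -/
def endpointValues (f : ℝ → ℝ) (p q a b : ℝ) : Set ℝ :=
  {r | ∃ v : ℝ → ℝ, ContinuousOn v (Icc a b) ∧ (∀ τ ∈ Icc a b, v τ ∈ Icc p q) ∧
    r = v b - ∫ τ in a..b, f τ * v τ}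

/-- Continuous weights that approximate, as `k → ∞`, the discontinuous optimal weight (`p` where
`f > 0`, and `q` elsewhere) while keeping the value `q` at the endpoint `b`. -/
noncomputable def rampWeight (f : ℝ → ℝ) (p q b : ℝ) (k : ℕ) (τ : ℝ) : ℝ :=
  q - (q - p) * min 1 (k * (max (f τ) 0 * (b - τ)))

theorem continuousOn_rampWeight (hf : ContinuousOn f (Icc a b)) (k : ℕ) :
    ContinuousOn (rampWeight f p q b k) (Icc a b) := by
  unfold rampWeight
  fun_prop

theorem rampWeight_mem_Icc (hpq : p ≤ q) (k : ℕ) {τ : ℝ} (hτ : τ ≤ b) :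
    rampWeight f p q b k τ ∈ Icc p q := by
  have hnonneg : 0 ≤ min 1 (k * (max (f τ) 0 * (b - τ))) :=
    le_min zero_le_one (mul_nonneg k.cast_nonneg
      (mul_nonneg (le_max_right _ _) (sub_nonneg.2 hτ)))
  have hle_one : min 1 (k * (max (f τ) 0 * (b - τ))) ≤ 1 := min_le_left _ _
  constructor <;> unfold rampWeight <;> nlinarith

theorem rampWeight_right (k : ℕ) : rampWeight f p q b k b = q := by
  simp [rampWeight]

theorem tendsto_rampWeight {τ : ℝ} (hτ : τ < b) :
    Tendsto (fun k => rampWeight f p q b k τ) atTop (𝓝 (if 0 < f τ then p else q)) := by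
  split_ifs with hpos
  · have hslope : 0 < max (f τ) 0 * (b - τ) := mul_pos (lt_max_of_lt_left hpos) (sub_pos.2 hτ)
    have hsat : ∀ᶠ k : ℕ in atTop, 1 ≤ k * (max (f τ) 0 * (b - τ)) :=
      (tendsto_natCast_atTop_atTop.atTop_mul_const hslope).eventually_ge_atTop 1
    refine tendsto_const_nhds.congr' (hsat.mono fun k hk => ?_)
    simp only [rampWeight, min_eq_left hk, mul_one, sub_sub_cancel]
  · simp [rampWeight, max_eq_right (not_lt.1 hpos)]

theorem ite_pos_mul_self (x : ℝ) :
    (if 0 < x then p else q) * x = q * min x 0 + p * max x 0 := by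
  split_ifs with hx
  · simp [hx.le]
  · simp [not_lt.1 hx]

theorem ite_pos_mul_self_le {v x : ℝ} (hv : v ∈ Icc p q) :
    (if 0 < x then p else q) * x ≤ x * v := by
  split_ifs with hx
  · nlinarith [hv.1]
  · nlinarith [hv.2]

theorem integral_ite_pos_mul_self (hab : a ≤ b) (hf : ContinuousOn f (Icc a b)) :
    ∫ τ in a..b, (if 0 < f τ then p else q) * f τ =
      q * (∫ τ in a..b, min (f τ) 0) + p * ∫ τ in a..b, max (f τ) 0 := by
  simp only [ite_pos_mul_self]
  rw [intervalIntegral.integral_add, intervalIntegral.integral_const_mul,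
    intervalIntegral.integral_const_mul] <;>
  exact ContinuousOn.intervalIntegrable_of_Icc hab (by fun_prop)

theorem le_of_mem_endpointValues (hab : a ≤ b) (hf : ContinuousOn f (Icc a b)) {r : ℝ}
    (hr : r ∈ endpointValues f p q a b) :
    r ≤ q - ∫ τ in a..b, (if 0 < f τ then p else q) * f τ := by
  obtain ⟨v, hv, hvpq, rfl⟩ := hr
  refine sub_le_sub (hvpq b (right_mem_Icc.2 hab)).2 (intervalIntegral.integral_mono_on hab ?_
    ((hf.mul hv).intervalIntegrable_of_Icc hab) fun τ hτ => ite_pos_mul_self_le (hvpq τ hτ))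
  simp only [ite_pos_mul_self]
  exact ContinuousOn.intervalIntegrable_of_Icc hab (by fun_prop)

theorem tendsto_integral_mul_rampWeight (hab : a ≤ b) (hpq : p ≤ q)
    (hf : ContinuousOn f (Icc a b)) :
    Tendsto (fun k => ∫ τ in a..b, f τ * rampWeight f p q b k τ) atTop
      (𝓝 (∫ τ in a..b, (if 0 < f τ then p else q) * f τ)) := by
  have hbound : ∀ k, ∀ τ ∈ Icc a b, |rampWeight f p q b k τ| ≤ max |p| |q| := fun k τ hτ =>
    have hmem := rampWeight_mem_Icc hpq k hτ.2
    abs_le_max_abs_abs hmem.1 hmem.2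
  have hlim : ∀ᵐ τ ∂volume.restrict (Ioc a b), Tendsto (fun k => rampWeight f p q b k τ) atTop
      (𝓝 (if 0 < f τ then p else q)) := by
    filter_upwards [ae_restrict_mem measurableSet_Ioc,
      ae_restrict_of_ae (Measure.ae_ne volume b)] with τ hτ hne
    exact tendsto_rampWeight (lt_of_le_of_ne hτ.2 hne)
  simpa only [smul_eq_mul, mul_comm (f _)] using tendsto_integral_smul_of_abs_le hab
    continuousOn_const hf (continuousOn_rampWeight hf) hbound hlim

theorem isLUB_endpointValues (hab : a ≤ b) (hpq : p ≤ q) (hf : ContinuousOn f (Icc a b)) :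
    IsLUB (endpointValues f p q a b)
      (q - q * (∫ τ in a..b, min (f τ) 0) - p * ∫ τ in a..b, max (f τ) 0) := by
  rw [sub_sub, ← integral_ite_pos_mul_self hab hf]
  refine ⟨fun r hr => le_of_mem_endpointValues hab hf hr, fun B hB => ?_⟩
  exact le_of_tendsto ((tendsto_integral_mul_rampWeight hab hpq hf).const_sub q)
    (.of_forall fun k => hB ⟨rampWeight f p q b k, continuousOn_rampWeight hf k,
      fun τ hτ => rampWeight_mem_Icc hpq k hτ.2, by rw [rampWeight_right]⟩)

theorem neg_mem_endpointValues {r : ℝ} (hr : r ∈ endpointValues f p q a b) :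
    -r ∈ endpointValues f (-q) (-p) a b := by
  obtain ⟨v, hv, hvpq, rfl⟩ := hr
  refine ⟨fun τ => -v τ, hv.neg,
    fun τ hτ => ⟨neg_le_neg (hvpq τ hτ).2, neg_le_neg (hvpq τ hτ).1⟩, ?_⟩
  simp only [mul_neg, intervalIntegral.integral_neg, sub_neg_eq_add, neg_sub]
  ring

theorem neg_endpointValues : -endpointValues f p q a b = endpointValues f (-q) (-p) a b := by
  ext r
  rw [Set.mem_neg]
  constructor <;> intro hr <;> simpa only [neg_neg] using neg_mem_endpointValues hr

theorem isGLB_endpointValues (hab : a ≤ b) (hpq : p ≤ q) (hf : ContinuousOn f (Icc a b)) :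
    IsGLB (endpointValues f p q a b)
      (p - p * (∫ τ in a..b, min (f τ) 0) - q * ∫ τ in a..b, max (f τ) 0) := by
  have hneg : -(p - p * (∫ τ in a..b, min (f τ) 0) - q * ∫ τ in a..b, max (f τ) 0) =
      -p - -p * (∫ τ in a..b, min (f τ) 0) - -q * ∫ τ in a..b, max (f τ) 0 := by ring
  rw [← isLUB_neg', neg_endpointValues, hneg]
  exact isLUB_endpointValues hab (neg_le_neg hpq) hf

theorem setIntegral_inter_nonpos {α : Type*} {mα : MeasurableSpace α} {ν : Measure α} {g : α → ℝ}
    (hg : Measurable g) (S : Set α) :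
    ∫ x in S ∩ {x | g x ≤ 0}, g x ∂ν = ∫ x in S, min (g x) 0 ∂ν := by
  rw [← setIntegral_indicator (measurableSet_le hg measurable_const)]
  congr with x
  by_cases hx : g x ≤ 0
  · simp [hx]
  · simp [hx, (not_le.1 hx).le]

theorem setIntegral_inter_pos {α : Type*} {mα : MeasurableSpace α} {ν : Measure α} {g : α → ℝ}
    (hg : Measurable g) (S : Set α) :
    ∫ x in S ∩ {x | 0 < g x}, g x ∂ν = ∫ x in S, max (g x) 0 ∂ν := by
  rw [← setIntegral_indicator (measurableSet_lt measurable_const hg)]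
  congr with x
  by_cases hx : 0 < g x
  · simp [hx, hx.le]
  · simp [hx, not_lt.1 hx]

end EndpointFunctional

section Canonical

variable {m : ℕ} {A : Matrix (Fin (m + 1)) (Fin (m + 1)) ℝ} {b : Fin (m + 1) → ℝ}

theorem IsControllable.isUnit_ctrbMatrix (h : IsControllable A b) : IsUnit (ctrbMatrix A b) :=
  Matrix.linearIndependent_cols_iff_isUnit.1 <| linearIndependent_iff_card_eq_finrank_span.2 <| by
    rw [Set.finrank, ← Matrix.rank_eq_finrank_span_cols, h, Fintype.card_fin]

theorem bcon_apply_eq_inv_mul_ctrbMatrix (i : Fin (m + 1)) :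
    bcon A b i = ((ctrbMatrix A b)⁻¹ * ctrbMatrix A b) (Fin.last m) i :=
  (Matrix.dotProduct_mulVec (qRow A b) (A ^ (i : ℕ)) b).symm

theorem bcon_eq_single (h : IsControllable A b) : bcon A b = Pi.single (Fin.last m) 1 := by
  ext i
  rw [bcon_apply_eq_inv_mul_ctrbMatrix,
    Matrix.nonsing_inv_mul _ ((Matrix.isUnit_iff_isUnit_det _).1 h.isUnit_ctrbMatrix),
    Matrix.one_apply, Pi.single_apply]
  simp only [eq_comm]

end Canonical

section InputRange

variable {m : ℕ} (A : Matrix (Fin (m + 1)) (Fin (m + 1)) ℝ) (b z₀ : Fin (m + 1) → ℝ)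

/-- The impulse response of the canonical form paired with the characteristic coefficients, so that
`kernelF A b s τ = impulse A b (s - τ)`. -/
noncomputable def impulse (r : ℝ) : ℝ :=
  charCoeff A ⬝ᵥ (NormedSpace.exp (r • Acon A b) *ᵥ bcon A b)

theorem continuous_impulse : Continuous (impulse A b) :=
  continuous_const.dotProduct (continuous_exp_smul_mulVec _ _)

theorem continuous_kernelF (s : ℝ) : Continuous (kernelF A b s) :=
  (continuous_impulse A b).comp (continuous_const.sub continuous_id)

variable {s : ℝ}

theorem intSub_eq_integral_kernelF (hs : 0 ≤ s) :
    intSub A b s = ∫ τ in (0 : ℝ)..s, min (kernelF A b s τ) 0 := by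
  rw [intervalIntegral.integral_of_le hs, ← integral_Icc_eq_integral_Ioc]
  exact setIntegral_inter_nonpos (continuous_kernelF A b s).measurable (Icc 0 s)

theorem intSuper_eq_integral_kernelF (hs : 0 ≤ s) :
    intSuper A b s = ∫ τ in (0 : ℝ)..s, max (kernelF A b s τ) 0 := by
  rw [intervalIntegral.integral_of_le hs, ← integral_Icc_eq_integral_Ioc]
  exact setIntegral_inter_pos (continuous_kernelF A b s).measurable (Icc 0 s)

theorem intSub_eq_integral_impulse (hs : 0 ≤ s) :
    intSub A b s = ∫ r in (0 : ℝ)..s, min (impulse A b r) 0 := by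
  rw [intSub_eq_integral_kernelF A b hs]
  have hsubst := intervalIntegral.integral_comp_sub_left (a := 0) (b := s)
    (fun r => min (impulse A b r) 0) s
  rwa [sub_self, sub_zero] at hsubst

theorem intSuper_eq_integral_impulse (hs : 0 ≤ s) :
    intSuper A b s = ∫ r in (0 : ℝ)..s, max (impulse A b r) 0 := by
  rw [intSuper_eq_integral_kernelF A b hs]
  have hsubst := intervalIntegral.integral_comp_sub_left (a := 0) (b := s)
    (fun r => max (impulse A b r) 0) s
  rwa [sub_self, sub_zero] at hsubst

theorem continuousOn_intSub : ContinuousOn (intSub A b) (Ici 0) :=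
  (intervalIntegral.continuous_primitive (fun _ _ => ((continuous_impulse A b).min
    continuous_const).intervalIntegrable _ _) 0).continuousOn.congr
      fun _ hs => intSub_eq_integral_impulse A b hs

theorem continuousOn_intSuper : ContinuousOn (intSuper A b) (Ici 0) :=
  (intervalIntegral.continuous_primitive (fun _ _ => ((continuous_impulse A b).max
    continuous_const).intervalIntegrable _ _) 0).continuousOn.congr
      fun _ hs => intSuper_eq_integral_impulse A b hs

variable {vmin vmax : ℝ}

theorem isGLB_valuesI (hv : vmin ≤ vmax) (hs : 0 ≤ s) :
    IsGLB (valuesI A b vmin vmax s) (vmin - vmin * intSub A b s - vmax * intSuper A b s) := by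
  rw [intSub_eq_integral_kernelF A b hs, intSuper_eq_integral_kernelF A b hs]
  exact isGLB_endpointValues hs hv (continuous_kernelF A b s).continuousOn

theorem isLUB_valuesI (hv : vmin ≤ vmax) (hs : 0 ≤ s) :
    IsLUB (valuesI A b vmin vmax s) (vmax - vmax * intSub A b s - vmin * intSuper A b s) := by
  rw [intSub_eq_integral_kernelF A b hs, intSuper_eq_integral_kernelF A b hs]
  exact isLUB_endpointValues hs hv (continuous_kernelF A b s).continuousOn

theorem nonempty_valuesI (hv : vmin ≤ vmax) (s : ℝ) : (valuesI A b vmin vmax s).Nonempty :=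
  ⟨_, fun _ => vmin, continuousOn_const, fun _ _ => left_mem_Icc.2 hv, rfl⟩

theorem Imin_eq (hv : vmin ≤ vmax) (hs : 0 ≤ s) :
    Imin A b vmin vmax s = vmin - vmin * intSub A b s - vmax * intSuper A b s :=
  (isGLB_valuesI A b hv hs).csInf_eq (nonempty_valuesI A b hv s)

theorem Imax_eq (hv : vmin ≤ vmax) (hs : 0 ≤ s) :
    Imax A b vmin vmax s = vmax - vmax * intSub A b s - vmin * intSuper A b s :=
  (isLUB_valuesI A b hv hs).csSup_eq (nonempty_valuesI A b hv s)

theorem continuousOn_Imin (hv : vmin ≤ vmax) : ContinuousOn (Imin A b vmin vmax) (Ici 0) :=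
  ((continuousOn_const.sub (continuousOn_const.mul (continuousOn_intSub A b))).sub
    (continuousOn_const.mul (continuousOn_intSuper A b))).congr fun _ hs => Imin_eq A b hv hs

theorem continuousOn_Imax (hv : vmin ≤ vmax) : ContinuousOn (Imax A b vmin vmax) (Ici 0) :=
  ((continuousOn_const.sub (continuousOn_const.mul (continuousOn_intSub A b))).sub
    (continuousOn_const.mul (continuousOn_intSuper A b))).congr fun _ hs => Imax_eq A b hv hs

theorem continuousOn_umin (hv : vmin ≤ vmax) : ContinuousOn (umin A b z₀ vmin vmax) (Ici 0) :=
  (continuous_const.dotProduct (continuous_exp_smul_mulVec _ _)).neg.continuousOn.add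
    (continuousOn_Imin A b hv)

theorem continuousOn_umax (hv : vmin ≤ vmax) : ContinuousOn (umax A b z₀ vmin vmax) (Ici 0) :=
  (continuous_const.dotProduct (continuous_exp_smul_mulVec _ _)).neg.continuousOn.add
    (continuousOn_Imax A b hv)

theorem umin_le_umax (hv : vmin ≤ vmax) (hs : 0 ≤ s) :
    umin A b z₀ vmin vmax s ≤ umax A b z₀ vmin vmax s := by
  have hI : Imin A b vmin vmax s ≤ Imax A b vmin vmax s :=
    csInf_le_csSup (nonempty_valuesI A b hv s) (isGLB_valuesI A b hv hs).bddBelow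
      (isLUB_valuesI A b hv hs).bddAbove
  unfold umin umax
  gcongr

end InputRange

end Reach

theorem corollary1 {m : ℕ} (A : Matrix (Fin (m + 1)) (Fin (m + 1)) ℝ)
    (b z₀ : Fin (m + 1) → ℝ) (hAb : Reach.IsControllable A b)
    (vmin vmax : ℝ) (hv : vmin ≤ vmax) (t : ℝ) (ht : 0 < t) :
    (∀ s ∈ Set.Icc 0 t,
      IsGLB (Reach.valuesI A b vmin vmax s)
        (vmin - vmin * Reach.intSub A b s - vmax * Reach.intSuper A b s) ∧
      IsLUB (Reach.valuesI A b vmin vmax s)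
        (vmax - vmax * Reach.intSub A b s - vmin * Reach.intSuper A b s)) ∧
    frontier (Reach.reachSet (Reach.Aint m) (Reach.bcon A b)
        (Reach.umin A b z₀ vmin vmax) (Reach.umax A b z₀ vmin vmax) t
        (Reach.canonM A b *ᵥ z₀)) =
      Reach.upperSurface (Reach.umin A b z₀ vmin vmax) (Reach.umax A b z₀ vmin vmax) t
          (Reach.canonM A b *ᵥ z₀) ∪
        Reach.lowerSurface (Reach.umin A b z₀ vmin vmax) (Reach.umax A b z₀ vmin vmax) t
          (Reach.canonM A b *ᵥ z₀) := by
  refine ⟨fun s hs => ⟨Reach.isGLB_valuesI A b hv hs.1, Reach.isLUB_valuesI A b hv hs.1⟩, ?_⟩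
  rw [Reach.bcon_eq_single hAb]
  exact Reach.frontier_reachSet_integrator ht.le
    ((Reach.continuousOn_umin A b z₀ hv).mono Icc_subset_Ici_self)
    ((Reach.continuousOn_umax A b z₀ hv).mono Icc_subset_Ici_self)
    (fun s hs => Reach.umin_le_umax A b z₀ hv hs.1) (Reach.canonM A b *ᵥ z₀)
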